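/- Let $X$ be a simplicial set. Write $\mathrm{sd}\,\Delta^n$ for the nerve of the poset of non-empty subsets of $\{0,\dots,n\}$, and let $\mathrm{Ex}\,X$ be the simplicial set with $(\mathrm{Ex}\,X)_n = \mathrm{Hom}_{\mathsf{sSet}}(\mathrm{sd}\,\Delta^n, X)$. Let $\bar\jmath_n : \mathrm{sd}\,\Delta^n \to \Delta^n$ be the last-vertex map, given on vertices by $\sigma \mapsto \max\sigma$; it is natural in $[n]$. Let $j : X \to \mathrm{Ex}\,X$ be the comparison map sending an $n$-simplex $\sigma : \Delta^n \to X$ to $\sigma\circ\bar\jmath_n$. **Theorem.** For every simplicial set $X$, the map $j : X \to \mathrm{Ex}\,X$ is a strong anodyne extension. That is, $j$ is a monomorphism, and there are an ordinal $\kappa$ and an increasing family $(A^\alpha)_{\alpha\le\kappa}$ of subcomplexes of $\mathrm{Ex}\,X$ such that - $A^0 = j(X)$ and $A^\kappa = \bigcup_{\alpha<\kappa} A^\alpha = \mathrm{Ex}\,X$; - $A^\lambda = \bigcup_{\alpha<\lambda} A^\alpha$ for every non-zero limit ordinal $\lambda<\kappa$; - for every $\alpha<\kappa$, the inclusion $A^\alpha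 \hookrightarrow A^{\alpha+1}$ is a pushout of a coproduct of horn inclusions $\Lambda^m_i \hookrightarrow \Delta^m$ (with $m\ge 1$ and $0\le i\le m$, where $m$ and $i$ may vary within the coproduct). -/

import Mathlib

open CategoryTheory Opposite Simplicial

universe u

namespace SSet

/-- The largest element of a nonempty subset `s` of `{0, ..., n}`. -/
def lastVertexOf {n : ℕ} (s : PartialOrder.NonemptyFiniteChains (ULift.{u} (Fin (n + 1)))) :
    Fin (n + 1) :=
  s.finset.sup' s.nonempty ULift.down

lemma lastVertexOf_mono {n : ℕ} :
    Monotone (lastVertexOf.{u} (n := n)) :=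
  fun s _ h ↦ Finset.sup'_mono _ h s.nonempty

lemma lastVertexOf_map {n m : ℕ}
    (s : PartialOrder.NonemptyFiniteChains (ULift.{u} (Fin (n + 1))))
    (f : ULift.{u} (Fin (n + 1)) →o ULift.{u} (Fin (m + 1))) :
    lastVertexOf (s.map f) = (f ⟨lastVertexOf s⟩).down := by
  apply le_antisymm
  · apply Finset.sup'_le
    intro y hy
    obtain ⟨x, hx, rfl⟩ := (s.mem_map_iff f y).1 hy
    exact f.monotone (Finset.le_sup' ULift.down hx)
  · obtain ⟨x, hx, h⟩ := Finset.exists_mem_eq_sup' s.nonempty ULift.down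
    have hx' : (⟨lastVertexOf s⟩ : ULift.{u} (Fin (n + 1))) = x := ULift.ext _ _ h
    rw [hx']
    exact Finset.le_sup' ULift.down ((s.mem_map_iff f _).2 ⟨x, hx, rfl⟩)

/-- The last-vertex map `sd Δ[n] ⟶ Δ[n]`. Here `SimplexCategory.sd.obj n` is the nerve of the
poset of nonempty subsets of `{0, ..., n}`. A chain `σ₀ ≤ ... ≤ σ_d` of
such subsets is sent to `max σ₀ ≤ ... ≤ max σ_d`. -/
def lastVertexApp (n : SimplexCategory) : SimplexCategory.sd.{u}.obj n ⟶ stdSimplex.{u}.obj n where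
  app _ := ↾fun s ↦ stdSimplex.objMk
    ⟨fun i ↦ lastVertexOf.{u} (n := n.len) (s.obj i),
      fun _ _ h ↦ lastVertexOf_mono (leOfHom (s.map (homOfLE h)))⟩
  naturality _ _ _ := rfl

/-- The last-vertex maps `sd Δ[n] ⟶ Δ[n]` are natural in `n`. -/
def lastVertex : SimplexCategory.sd.{u} ⟶ stdSimplex.{u} where
  app := lastVertexApp
  naturality n m f := by
    ext d s
    apply stdSimplex.objEquiv.injective
    ext i : 3
    exact lastVertexOf_map (n := n.len) (m := m.len) (s.obj i)
      (SimplexCategory.toPartOrd.{u}.map f).hom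

/-- The comparison map `j : X ⟶ Ex X`. It sends an `n`-simplex of `X`, seen as a morphism
`σ : Δ[n] ⟶ X`, to the composition `sd Δ[n] ⟶ Δ[n] ⟶ X` of the last-vertex map and `σ`. -/
noncomputable def toEx (X : SSet.{u}) : X ⟶ ex.{u}.obj X where
  app n := ↾fun x ↦ ULift.up (lastVertex.{u}.app n.unop ≫ yonedaEquiv.symm x)
  naturality n m f := by
    ext x
    have h : stdSimplex.{u}.map f.unop ≫ yonedaEquiv.symm x = yonedaEquiv.symm (X.map f x) :=
      yonedaEquiv_symm_naturality_left f.unop x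
    have h' := lastVertex.{u}.naturality f.unop
    apply ULift.down_injective
    change lastVertex.{u}.app m.unop ≫ yonedaEquiv.symm (X.map f x) =
      SimplexCategory.sd.map f.unop ≫ lastVertex.{u}.app n.unop ≫ yonedaEquiv.symm x
    rw [← h, ← Category.assoc, ← Category.assoc, h']

/-- An anodyne presentation of the inclusion in `B` of a subcomplex `A`: an ordinal `κ` and an
increasing family of subcomplexes of `B`, indexed by the ordinals `α ≤ κ`, which starts with `A`,
ends with `B`, is continuous, and in which each step is a pushout of a
coproduct of horn inclusions `Λ[n, i] ⟶ Δ[n]` (with `1 ≤ n` and `0 ≤ i ≤ n`). -/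
structure AnodynePresentation {B : SSet.{u}} (A : B.Subcomplex) where
  /-- the length of the presentation -/
  κ : Ordinal.{u}
  /-- the family of subcomplexes -/
  filtration : Set.Iic κ → B.Subcomplex
  monotone : Monotone filtration
  zero : filtration ⟨0, Set.mem_Iic.2 zero_le⟩ = A
  last : filtration ⟨κ, Set.mem_Iic.2 le_rfl⟩ = ⊤
  iSup_lt : ⨆ (α : Set.Iic κ) (_ : α.1 < κ), filtration α = ⊤
  limit (l : Set.Iic κ) (hl : l.1 < κ) (hl' : Order.IsSuccLimit l.1) :
    ⨆ (α : Set.Iic κ) (_ : α < l), filtration α = filtration l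
  step (α : Ordinal.{u}) (hα : α < κ) :
    (MorphismProperty.coproducts.{u} modelCategoryQuillen.J.{u}).pushouts
      (Subcomplex.homOfLE (monotone (show
        (⟨α, hα.le⟩ : Set.Iic κ) ≤ ⟨Order.succ α, Order.succ_le_of_lt hα⟩ from Order.le_succ α)))

/-- A morphism `m : A ⟶ B` is a strong anodyne extension if it is a monomorphism and (the inclusion
of its image) admits an anodyne presentation. -/
def IsStrongAnodyneExtension {A B : SSet.{u}} (m : A ⟶ B) : Prop :=
  Mono m ∧ Nonempty (AnodynePresentation (Subcomplex.range m))

end SSet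

/-! ### Anodyne presentations from regular pairings -/

namespace SSet

namespace Subcomplex.Pairing

variable {B : SSet.{u}} {A : B.Subcomplex} {P : A.Pairing}

/-! Monotone maps between posets of faces act on simplices of `Ex X` by precomposition. Filling
above k keeps a set s with max s ≤ k and replaces any other s by {0, ..., max s}. Since i ↦ {0, ...,
i} is a section of the last-vertex map, j is mono and j(X) consists of the simplices invariant under
filling above 0 (`mem_range_toEx_iff`). The least k for which x is invariant, its fill index,
measures how far x is from j(X).

A simplex x of index i > 0 is the face i + 1 of `extend i x`, obtained by doubling the vertex i and
filling above i. Every other face has smaller index or is itself an extension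
(`fillIndex_lt_or_isExtended_of_δ_extend`). So the nondegenerate simplices outside j(X) split into
pairs (x, `extend i x`) with x not an extension (`extend_mem_nonDegenerate`, `δ_mem_nonDegenerate`,
`not_isExtended_δ`), and each pair is attached along the horn that omits the face x. If the seed x
is a face of the extension of another seed of the same dimension, its index is strictly smaller;
hence the pairing is regular and the horns are attached in ω stages. -/

lemma RankFunction.pushouts_filtration_le_succ (f : P.RankFunction ℕ) [P.IsProper] (n : ℕ) :
    (MorphismProperty.coproducts.{u} modelCategoryQuillen.J.{u}).pushouts
      (Subcomplex.homOfLE (f.filtration_monotone (Order.le_succ n))) := by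
  refine MorphismProperty.pushouts_mk _ (f.isPushout n) ?_
  rw [MorphismProperty.coproducts_iff]
  exact ⟨f.Cell n, MorphismProperty.colimitsOfShape_colimMap _
    (fun _ ↦ modelCategoryQuillen.horn_ι_mem_J _ _)⟩

/-- The filtration attached to a rank function with values in `ℕ`, indexed by ordinals. -/
def RankFunction.ordinalFiltration (f : P.RankFunction ℕ) (α : Ordinal.{u}) : B.Subcomplex :=
  ⨆ (n : ℕ) (_ : (n : Ordinal.{u}) ≤ α), f.filtration n

namespace RankFunction

variable (f : P.RankFunction ℕ)

lemma ordinalFiltration_monotone : Monotone f.ordinalFiltration :=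
  fun _ _ h ↦ iSup₂_le fun n hn ↦ le_iSup₂_of_le n (hn.trans h) le_rfl

@[simp]
lemma ordinalFiltration_natCast (n : ℕ) : f.ordinalFiltration n = f.filtration n :=
  le_antisymm (iSup₂_le fun _ hm ↦ f.filtration_monotone (Nat.cast_le.1 hm))
    (le_iSup₂_of_le n le_rfl le_rfl)

lemma ordinalFiltration_succ_natCast (n : ℕ) :
    f.ordinalFiltration (Order.succ (n : Ordinal.{u})) = f.filtration (Order.succ n) := by
  rw [← ordinalFiltration_natCast, Order.succ_eq_add_one, Order.succ_eq_add_one, Nat.cast_add,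
    Nat.cast_one]

lemma iSup_ordinalFiltration_natCast [P.IsProper] :
    ⨆ (n : ℕ), f.ordinalFiltration n = ⊤ := by
  simp [f.iSup_filtration]

end RankFunction

/-- The anodyne presentation of length `ω` attached to a regular pairing. -/
noncomputable def anodynePresentation (P : A.Pairing) [P.IsRegular] : AnodynePresentation A where
  κ := Ordinal.omega0
  filtration α := P.rankFunction.ordinalFiltration α.1
  monotone _ _ h := P.rankFunction.ordinalFiltration_monotone h
  zero := by
    have h := P.rankFunction.ordinalFiltration_natCast 0
    rw [Nat.cast_zero] at h
    exact h.trans P.rankFunction.filtration_bot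
  last := by
    rw [eq_top_iff, ← P.rankFunction.iSup_ordinalFiltration_natCast]
    exact iSup_le fun n ↦
      P.rankFunction.ordinalFiltration_monotone (Ordinal.natCast_lt_omega0 n).le
  iSup_lt := by
    rw [eq_top_iff, ← P.rankFunction.iSup_ordinalFiltration_natCast]
    exact iSup_le fun n ↦ le_iSup₂_of_le (f := fun (α : Set.Iic Ordinal.omega0.{u})
      (_ : α.1 < Ordinal.omega0.{u}) ↦ P.rankFunction.ordinalFiltration α.1)
      ⟨n, (Ordinal.natCast_lt_omega0 n).le⟩ (Ordinal.natCast_lt_omega0 n) le_rfl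
  -- There is no limit ordinal below ω.
  limit l hl hl' := (hl.not_ge (Ordinal.omega0_le_of_isSuccLimit hl')).elim
  step α hα := by
    obtain ⟨n, rfl⟩ := Ordinal.lt_omega0.1 hα
    -- The stages agree with those of the rank function only propositionally, so they are
    -- generalized before substitution.
    have h (C D : B.Subcomplex) (hC : C = P.rankFunction.filtration n)
        (hD : D = P.rankFunction.filtration (Order.succ n)) (hCD : C ≤ D) :
        (MorphismProperty.coproducts.{u} modelCategoryQuillen.J.{u}).pushouts
          (Subcomplex.homOfLE hCD) := by
      subst hC hD
      exact P.rankFunction.pushouts_filtration_le_succ n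
    exact h _ _ (P.rankFunction.ordinalFiltration_natCast n)
      (P.rankFunction.ordinalFiltration_succ_natCast n) _

end Subcomplex.Pairing

end SSet

/-! ### Filling maps between posets of faces -/

namespace SSet

/-- The nonempty subsets of `{0, ..., n}`, i.e. the vertices of the subdivision of `Δ[n]`. -/
abbrev Faces (n : ℕ) : Type u := PartialOrder.NonemptyFiniteChains (ULift.{u} (Fin (n + 1)))

namespace Faces

variable {l m n : ℕ}

/-- The initial segment `{0, ..., a}`. -/
def initial (a : Fin (n + 1)) : Faces.{u} n where
  finset := Finset.univ.filter (fun b ↦ b.down ≤ a)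
  nonempty := ⟨⟨a⟩, by simp⟩
  comparable _ _ := le_total _ _

@[simp]
lemma mem_initial (a : Fin (n + 1)) (b : ULift.{u} (Fin (n + 1))) :
    b ∈ (initial a).finset ↔ b.down ≤ a := by
  simp [initial]

lemma down_le_lastVertexOf (s : Faces.{u} n) {b : ULift.{u} (Fin (n + 1))} (hb : b ∈ s.finset) :
    b.down ≤ lastVertexOf s :=
  Finset.le_sup' ULift.down hb

lemma lastVertexOf_mem (s : Faces.{u} n) : ULift.up (lastVertexOf s) ∈ s.finset := by
  obtain ⟨x, hx, h⟩ := Finset.exists_mem_eq_sup' s.nonempty ULift.down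
  have : ULift.up (lastVertexOf s) = x := ULift.ext _ _ h
  rwa [this]

lemma le_initial_lastVertexOf (s : Faces.{u} n) : s ≤ initial (lastVertexOf s) :=
  fun _ hb ↦ (mem_initial _ _).2 (down_le_lastVertexOf s hb)

@[simp]
lemma lastVertexOf_initial (a : Fin (n + 1)) : lastVertexOf (initial.{u} a) = a :=
  le_antisymm ((mem_initial _ _).1 (lastVertexOf_mem (initial.{u} a)))
    (down_le_lastVertexOf (initial.{u} a) (b := ⟨a⟩) (by simp))

lemma initial_monotone : Monotone (initial.{u} (n := n)) :=
  fun _ _ h b hb ↦ by simp only [mem_initial] at hb ⊢; exact hb.trans h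

lemma ext_down {s t : Faces.{u} n}
    (h : ∀ a : Fin (n + 1), ULift.up a ∈ s.finset ↔ ULift.up a ∈ t.finset) : s = t := by
  ext ⟨a⟩
  exact h a

/-- The direct image of nonempty subsets. -/
noncomputable def map (f : ⦋m⦌ ⟶ ⦋n⦌) : Faces.{u} m →o Faces.{u} n :=
  PartialOrder.NonemptyFiniteChains.orderHomMap (SimplexCategory.toPartOrd.{u}.map f).hom

lemma mem_map (f : ⦋m⦌ ⟶ ⦋n⦌) (s : Faces.{u} m) (b : Fin (n + 1)) :
    ULift.up b ∈ (map f s).finset ↔ ∃ a, ULift.up a ∈ s.finset ∧ f a = b := by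
  refine (s.mem_map_iff _ _).trans ⟨?_, ?_⟩
  · rintro ⟨⟨a⟩, ha, h⟩
    exact ⟨a, ha, congr_arg ULift.down h⟩
  · rintro ⟨a, ha, rfl⟩
    exact ⟨⟨a⟩, ha, rfl⟩

@[simp]
lemma lastVertexOf_map (f : ⦋m⦌ ⟶ ⦋n⦌) (s : Faces.{u} m) :
    lastVertexOf (map f s) = f (lastVertexOf s) :=
  SSet.lastVertexOf_map (n := m) (m := n) s (SimplexCategory.toPartOrd.{u}.map f).hom

lemma map_comp (f : ⦋l⦌ ⟶ ⦋m⦌) (g : ⦋m⦌ ⟶ ⦋n⦌) (s : Faces.{u} l) :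
    map (f ≫ g) s = map g (map f s) := by
  refine ext_down fun a ↦ ?_
  simp [mem_map]

@[simp]
lemma map_id (s : Faces.{u} n) : map (𝟙 ⦋n⦌) s = s := by
  refine ext_down fun a ↦ ?_
  simp [mem_map]

/-- Given `f : ⦋m⦌ ⟶ ⦋n⦌` and `k : ℕ`, this is the monotone map sending a nonempty subset `s` of
`{0, ..., m}` to its direct image by `f` if the last vertex of `s` is `≤ k`, and
to the initial segment with the same last vertex as this direct image otherwise. -/
noncomputable def mapFill (k : ℕ) (f : ⦋m⦌ ⟶ ⦋n⦌) : Faces.{u} m →o Faces.{u} n where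
  toFun s := if (lastVertexOf s).val ≤ k then map f s else initial (lastVertexOf (map f s))
  monotone' s t h := by
    dsimp only
    split_ifs with hs ht ht
    · exact (map f).monotone h
    · exact ((map f).monotone h).trans (le_initial_lastVertexOf _)
    · exact (hs (le_trans (lastVertexOf_mono h) ht)).elim
    · exact initial_monotone (lastVertexOf_mono ((map f).monotone h))

lemma mapFill_of_le {k : ℕ} (f : ⦋m⦌ ⟶ ⦋n⦌) {s : Faces.{u} m} (h : (lastVertexOf s).val ≤ k) :
    mapFill k f s = map f s :=
  if_pos h

lemma mapFill_of_lt {k : ℕ} (f : ⦋m⦌ ⟶ ⦋n⦌) {s : Faces.{u} m} (h : k < (lastVertexOf s).val) :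
    mapFill k f s = initial (f (lastVertexOf s)) := by
  rw [← lastVertexOf_map]
  exact if_neg h.not_ge

lemma mapFill_eq_map {k : ℕ} (h : m ≤ k) (f : ⦋m⦌ ⟶ ⦋n⦌) : mapFill.{u} k f = map f := by
  ext s : 2
  exact mapFill_of_le f (by have := (lastVertexOf s).isLt; lia)

lemma map_initial (f : ⦋m⦌ ⟶ ⦋n⦌) (a : Fin (m + 1))
    (h : ∀ b ≤ f a, ∃ c ≤ a, f c = b) : map f (initial.{u} a) = initial (f a) := by
  refine ext_down fun b ↦ ?_
  simp only [mem_map, mem_initial]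
  exact ⟨by rintro ⟨c, hc, rfl⟩; exact f.toOrderHom.monotone hc, h b⟩

/-- By `hc`, a set stays unfilled exactly when neither map fills it. The delicate case is a set
filled by the first map only: the direct image under `g` of the resulting initial segment must again
be initial, which is what `h` provides. -/
lemma mapFill_comp {c k k' : ℕ} (f : ⦋l⦌ ⟶ ⦋m⦌) (g : ⦋m⦌ ⟶ ⦋n⦌)
    (hc : ∀ a, a.val ≤ c ↔ a.val ≤ k ∧ (f a).val ≤ k')
    (h : ∀ a : Fin (l + 1), k < a.val → (f a).val ≤ k' → ∀ b ≤ g (f a), ∃ d ≤ f a, g d = b) :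
    (mapFill.{u} k' g).comp (mapFill k f) = mapFill c (f ≫ g) := by
  ext s : 2
  change mapFill k' g (mapFill k f s) = _
  have hcs := hc (lastVertexOf s)
  obtain h₁ | h₁ := le_or_gt (lastVertexOf s).val k
  · rw [mapFill_of_le f h₁]
    obtain h₂ | h₂ := le_or_gt (f (lastVertexOf s)).val k'
    · rw [mapFill_of_le g (by simpa using h₂), mapFill_of_le _ (hcs.2 ⟨h₁, h₂⟩), map_comp]
    · rw [mapFill_of_lt g (by simpa using h₂), mapFill_of_lt _ (by lia)]
      simp
  · rw [mapFill_of_lt f h₁, mapFill_of_lt (k := c) _ (by lia)]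
    obtain h₂ | h₂ := le_or_gt (f (lastVertexOf s)).val k'
    · rw [mapFill_of_le g (by simpa using h₂), map_initial g _ (h _ h₁ h₂)]
      simp
    · rw [mapFill_of_lt g (by simpa using h₂)]
      simp

end Faces

end SSet

/-! ### Values of cofaces, codegeneracies and collapses -/

namespace SimplexCategory

variable {m n : ℕ}

lemma hom_ext_val {f g : ⦋m⦌ ⟶ ⦋n⦌} (h : ∀ a : Fin (m + 1), (f a).val = (g a).val) : f = g :=
  ConcreteCategory.hom_ext _ _ fun a ↦ Fin.ext (h a)

lemma val_δ (i : Fin (n + 2)) (a : Fin (n + 1)) :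
    (δ i a).val = if a.val < i.val then a.val else a.val + 1 := by
  change (i.succAbove a).val = _
  simp only [Fin.succAbove, Fin.lt_def]
  split_ifs <;> simp_all

lemma val_σ (i : Fin (n + 1)) (a : Fin (n + 2)) :
    (σ i a).val = if a.val ≤ i.val then a.val else a.val - 1 := by
  change (i.predAbove a).val = _
  simp only [Fin.predAbove, Fin.lt_def, Fin.val_castSucc]
  split_ifs
  all_goals simp_all
  all_goals lia

/-- The map `⦋n⦌ ⟶ ⦋n⦌` which sends `k + 1` to `k` and fixes the other elements. -/
def collapse (n k : ℕ) : ⦋n⦌ ⟶ ⦋n⦌ :=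
  mkHom
    { toFun a := ⟨if a.val = k + 1 then k else a.val, by have := a.isLt; split_ifs <;> lia⟩
      monotone' a b h := by
        simp only [Fin.le_def] at h ⊢
        split_ifs <;> lia }

lemma val_collapse (k : ℕ) (a : Fin (n + 1)) :
    (collapse n k a).val = if a.val = k + 1 then k else a.val := rfl

lemma not_mono_collapse {k : ℕ} (h : k < n) : ¬ Mono (collapse n k) := by
  rw [mono_iff_injective]
  intro hf
  have := @hf ⟨k + 1, by lia⟩ ⟨k, by lia⟩ (Fin.ext (by
    change ite _ _ _ = ite _ _ _
    simp))
  simp at this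

end SimplexCategory

/-! ### The filling operators on `Ex X` -/

namespace SSet

namespace Faces

variable {l m n : ℕ}

lemma mapFill_comp_of_lt {c k k' : ℕ} (f : ⦋l⦌ ⟶ ⦋m⦌) (g : ⦋m⦌ ⟶ ⦋n⦌)
    (hc : ∀ a, a.val ≤ c ↔ a.val ≤ k ∧ (f a).val ≤ k')
    (h : ∀ a : Fin (l + 1), k < a.val → k' < (f a).val) :
    (mapFill.{u} k' g).comp (mapFill k f) = mapFill c (f ≫ g) :=
  mapFill_comp f g hc fun a h₁ h₂ ↦ ((h a h₁).not_ge h₂).elim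

lemma mapFill_comp_of_val_eq {c k k' : ℕ} (f : ⦋l⦌ ⟶ ⦋m⦌) (g : ⦋m⦌ ⟶ ⦋n⦌)
    (hc : ∀ a, a.val ≤ c ↔ a.val ≤ k ∧ (f a).val ≤ k')
    (h : ∀ a : Fin (m + 1), a.val ≤ k' → (g a).val = a.val) :
    (mapFill.{u} k' g).comp (mapFill k f) = mapFill c (f ≫ g) :=
  mapFill_comp f g hc fun a _ h₂ b hb ↦ by
    have hb' : b.val ≤ (f a).val := (Fin.le_def.1 hb).trans (h _ h₂).le
    exact ⟨⟨b, by have := (f a).isLt; lia⟩, hb', Fin.ext (h _ (hb'.trans h₂))⟩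

/-- A surjective monotone map carries initial segments to initial segments, whatever the thresholds.
-/
lemma mapFill_comp_of_epi {c k k' : ℕ} (f : ⦋l⦌ ⟶ ⦋m⦌) (g : ⦋m⦌ ⟶ ⦋n⦌) [Epi g]
    (hc : ∀ a, a.val ≤ c ↔ a.val ≤ k ∧ (f a).val ≤ k') :
    (mapFill.{u} k' g).comp (mapFill k f) = mapFill c (f ≫ g) :=
  mapFill_comp f g hc fun a _ _ b hb ↦ by
    obtain ⟨d, rfl⟩ := SimplexCategory.epi_iff_surjective.1 ‹Epi g› b
    obtain hd | hd := le_total d (f a)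
    · exact ⟨d, hd, rfl⟩
    · exact ⟨f a, le_rfl, le_antisymm (g.toOrderHom.monotone hd) hb⟩

end Faces

namespace Ex

open SimplexCategory (val_δ val_σ val_collapse collapse)

variable {X : SSet.{u}} {l m n : ℕ}

/-- The simplex of `Ex X` obtained by composing a simplex with the map between subdivisions of
standard simplices that is induced by a monotone map. -/
noncomputable def precomp (φ : Faces.{u} m →o Faces.{u} n) (x : (ex.obj X) _⦋n⦌) :
    (ex.obj X) _⦋m⦌ :=
  ULift.up (PartOrd.nerveFunctor.map (PartOrd.ofHom φ) ≫ x.down)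

lemma precomp_precomp (φ : Faces.{u} l →o Faces.{u} m) (ψ : Faces.{u} m →o Faces.{u} n)
    (x : (ex.obj X) _⦋n⦌) :
    precomp φ (precomp ψ x) = precomp (ψ.comp φ) x :=
  ULift.down_injective rfl

lemma map_eq_precomp (f : ⦋m⦌ ⟶ ⦋n⦌) (x : (ex.obj X) _⦋n⦌) :
    (ex.obj X).map f.op x = precomp (Faces.map f) x := rfl

/-- The action of `Faces.mapFill k f` on the simplices of `Ex X`. -/
noncomputable def fill (k : ℕ) (f : ⦋m⦌ ⟶ ⦋n⦌) (x : (ex.obj X) _⦋n⦌) : (ex.obj X) _⦋m⦌ :=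
  precomp (Faces.mapFill k f) x

lemma fill_eq_map {k : ℕ} (h : m ≤ k) (f : ⦋m⦌ ⟶ ⦋n⦌) (x : (ex.obj X) _⦋n⦌) :
    fill k f x = (ex.obj X).map f.op x := by
  rw [fill, Faces.mapFill_eq_map h, map_eq_precomp]

lemma fill_fill_of_lt {k k' : ℕ} (c : ℕ) (f : ⦋l⦌ ⟶ ⦋m⦌) (g : ⦋m⦌ ⟶ ⦋n⦌)
    (hc : ∀ a, a.val ≤ c ↔ a.val ≤ k ∧ (f a).val ≤ k')
    (h : ∀ a : Fin (l + 1), k < a.val → k' < (f a).val) (x : (ex.obj X) _⦋n⦌) :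
    fill k f (fill k' g x) = fill c (f ≫ g) x := by
  simp only [fill, precomp_precomp, Faces.mapFill_comp_of_lt f g hc h]

lemma fill_fill_of_val_eq {k k' : ℕ} (c : ℕ) (f : ⦋l⦌ ⟶ ⦋m⦌) (g : ⦋m⦌ ⟶ ⦋n⦌)
    (hc : ∀ a, a.val ≤ c ↔ a.val ≤ k ∧ (f a).val ≤ k')
    (h : ∀ a : Fin (m + 1), a.val ≤ k' → (g a).val = a.val) (x : (ex.obj X) _⦋n⦌) :
    fill k f (fill k' g x) = fill c (f ≫ g) x := by
  simp only [fill, precomp_precomp, Faces.mapFill_comp_of_val_eq f g hc h]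

lemma fill_map {k : ℕ} (f : ⦋l⦌ ⟶ ⦋m⦌) (g : ⦋m⦌ ⟶ ⦋n⦌) [Epi g] (x : (ex.obj X) _⦋n⦌) :
    fill k f ((ex.obj X).map g.op x) = fill k (f ≫ g) x := by
  rw [← fill_eq_map le_rfl]
  simp only [fill, precomp_precomp]
  rw [Faces.mapFill_comp_of_epi]
  intro a
  have := (f a).isLt
  constructor <;> intro _ <;> lia

/-- The ordinary action of `f` is a filling with threshold at least the dimension, so only the
threshold of `g` matters, pulled back along `f`. -/
lemma map_fill {k : ℕ} (c : ℕ) (f : ⦋l⦌ ⟶ ⦋m⦌) (g : ⦋m⦌ ⟶ ⦋n⦌)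
    (hc : ∀ a, a.val ≤ c ↔ (f a).val ≤ k) (x : (ex.obj X) _⦋n⦌) :
    (ex.obj X).map f.op (fill k g x) = fill c (f ≫ g) x := by
  rw [← fill_eq_map le_rfl]
  refine fill_fill_of_lt _ _ _ (fun a ↦ ?_) (fun a ↦ ?_) _
  · rw [hc]; have := a.isLt; constructor <;> intro _ <;> lia
  · intro _; have := a.isLt; lia

/-- The condition that a simplex of `Ex X` is invariant under filling above `k`. -/
def IsFilled (k : ℕ) (x : (ex.obj X) _⦋n⦌) : Prop := fill k (𝟙 _) x = x

lemma isFilled_of_le {k : ℕ} (h : n ≤ k) (x : (ex.obj X) _⦋n⦌) : IsFilled k x := by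
  simp [IsFilled, fill_eq_map h]

lemma isFilled_fill (k : ℕ) (f : ⦋m⦌ ⟶ ⦋n⦌) (x : (ex.obj X) _⦋n⦌) : IsFilled k (fill k f x) := by
  refine (fill_fill_of_lt k _ _ (fun a ↦ ?_) (fun a ha ↦ ha) x).trans (by rw [Category.id_comp])
  simp

end Ex
end SSet

/-! ### Fill index and extension of a simplex -/

namespace SSet.Ex

open SimplexCategory (val_δ val_σ val_collapse collapse hom_ext_val not_mono_collapse)

variable {X : SSet.{u}} {l m n : ℕ}

lemma IsFilled.mono {j k : ℕ} {x : (ex.obj X) _⦋n⦌} (hx : IsFilled j x) (h : j ≤ k) :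
    IsFilled k x := by
  have := fill_fill_of_val_eq (k := k) j (𝟙 _) (𝟙 _)
    (fun a ↦ ⟨fun ha ↦ ⟨ha.trans h, ha⟩, And.right⟩) (fun _ _ ↦ rfl) x
  rwa [Category.id_comp, hx] at this

lemma IsFilled.δ_of_lt {k : ℕ} {x : (ex.obj X) _⦋n + 1⦌} (hx : IsFilled k x)
    {i : Fin (n + 2)} (hi : k < i.val) : IsFilled k ((ex.obj X).δ i x) := by
  have : (ex.obj X).δ i x = fill k (SimplexCategory.δ i) x := by
    conv_lhs => rw [← hx]
    refine (map_fill k _ _ (fun a ↦ ?_) x).trans (by rw [Category.comp_id])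
    rw [val_δ]
    split_ifs <;> lia
  rw [this]
  apply isFilled_fill

lemma IsFilled.δ_of_le {k : ℕ} {x : (ex.obj X) _⦋n + 1⦌} (hx : IsFilled (k + 1) x)
    {i : Fin (n + 2)} (hi : i.val ≤ k + 1) : IsFilled k ((ex.obj X).δ i x) := by
  have : (ex.obj X).δ i x = fill k (SimplexCategory.δ i) x := by
    conv_lhs => rw [← hx]
    refine (map_fill k _ _ (fun a ↦ ?_) x).trans (by rw [Category.comp_id])
    rw [val_δ]
    split_ifs <;> lia
  rw [this]
  apply isFilled_fill

/-- The simplex is invariant under the map that moves k + 1 to k + 2 and fixes the rest; the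
preimage of {0, ..., k + 1} under it is {0, ..., k}, so the threshold drops by one. -/
lemma IsFilled.of_eq_σ {k : ℕ} {z : (ex.obj X) _⦋n⦌} {i : Fin (n + 1)} (hi : i.val = k + 1)
    (hx : IsFilled (k + 1) ((ex.obj X).σ i z)) :
    IsFilled k ((ex.obj X).σ i z) := by
  let α : ⦋n + 1⦌ ⟶ ⦋n + 1⦌ := SimplexCategory.σ i ≫ SimplexCategory.δ i.castSucc
  have h₁ : (ex.obj X).map α.op ((ex.obj X).σ i z) = (ex.obj X).σ i z := by
    dsimp [SimplicialObject.σ]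
    rw [← Functor.map_comp_apply, ← op_comp, Category.assoc, SimplexCategory.δ_comp_σ_self,
      Category.comp_id]
  have h₂ : (ex.obj X).map α.op ((ex.obj X).σ i z) = fill k α ((ex.obj X).σ i z) := by
    conv_lhs => rw [← hx]
    refine (map_fill k _ _ (fun a ↦ ?_) _).trans (by rw [Category.comp_id])
    change _ ↔ (SimplexCategory.δ i.castSucc (SimplexCategory.σ i a)).val ≤ k + 1
    rw [val_δ, val_σ, Fin.val_castSucc]
    split_ifs <;> lia
  rw [← h₁, h₂]
  apply isFilled_fill

/-- The smallest `k` such that a simplex of `Ex X` is invariant under filling above `k`. -/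
noncomputable def fillIndex (x : (ex.obj X) _⦋n⦌) : ℕ := sInf (Set.ofPred fun k ↦ IsFilled k x)

lemma isFilled_fillIndex (x : (ex.obj X) _⦋n⦌) : IsFilled (fillIndex x) x :=
  Nat.sInf_mem (s := Set.ofPred fun k ↦ IsFilled k x) ⟨n, isFilled_of_le le_rfl x⟩

lemma isFilled_iff (x : (ex.obj X) _⦋n⦌) (k : ℕ) : IsFilled k x ↔ fillIndex x ≤ k :=
  ⟨fun h ↦ Nat.sInf_le h, fun h ↦ (isFilled_fillIndex x).mono h⟩

lemma fillIndex_le (x : (ex.obj X) _⦋n⦌) : fillIndex x ≤ n :=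
  (isFilled_iff x n).1 (isFilled_of_le le_rfl x)

/-- The condition that a simplex `x` of `Ex X` is obtained from one of its faces by `extend`. -/
def IsExtended (x : (ex.obj X) _⦋n⦌) : Prop :=
  fillIndex x < n ∧ fill (fillIndex x) (collapse n (fillIndex x)) x = x

/-- The `n + 1`-simplex having an `n`-simplex `x` which is invariant by filling above `i` as its
face of index `i + 1`. -/
noncomputable def extend (i : Fin (n + 1)) (x : (ex.obj X) _⦋n⦌) : (ex.obj X) _⦋n + 1⦌ :=
  fill i.val (SimplexCategory.σ i) x

lemma isFilled_extend (i : Fin (n + 1)) (x : (ex.obj X) _⦋n⦌) : IsFilled i.val (extend i x) :=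
  isFilled_fill _ _ _

lemma δ_extend {i : Fin (n + 1)} {x : (ex.obj X) _⦋n⦌} (hx : IsFilled i.val x) :
    (ex.obj X).δ i.succ (extend i x) = x := by
  refine (map_fill i.val _ _ (fun a ↦ ?_) x).trans ?_
  · rw [val_δ, Fin.val_succ]
    split_ifs <;> lia
  · rw [SimplexCategory.δ_comp_σ_succ, hx]

/-- A smaller threshold would be inherited by the face i + 1, which is `x`. -/
lemma fillIndex_extend {i : Fin (n + 1)} {x : (ex.obj X) _⦋n⦌} (hi : fillIndex x = i.val) :
    fillIndex (extend i x) = i.val := by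
  refine le_antisymm ((isFilled_iff _ _).1 (isFilled_extend i x)) ?_
  by_contra! h
  have := (isFilled_fillIndex (extend i x)).δ_of_lt (i := i.succ) (by rw [Fin.val_succ]; lia)
  rw [δ_extend ((isFilled_iff _ _).2 hi.le), isFilled_iff] at this
  lia

lemma isExtended_extend {i : Fin (n + 1)} {x : (ex.obj X) _⦋n⦌} (hi : fillIndex x = i.val) :
    IsExtended (extend i x) := by
  refine ⟨by rw [fillIndex_extend hi]; exact i.isLt, ?_⟩
  rw [fillIndex_extend hi]
  refine (fill_fill_of_val_eq i.val _ _ (fun a ↦ ?_) (fun a ha ↦ ?_) x).trans ?_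
  · rw [val_collapse]
    split_ifs <;> lia
  · rw [val_σ, if_pos ha]
  · congr 1
    refine hom_ext_val fun a ↦ ?_
    change (SimplexCategory.σ i (collapse _ _ a)).val = _
    rw [val_σ, val_collapse, val_σ]
    split_ifs <;> lia

/-- The faces of `extend i x` other than `x` have a smaller fill index or are extended. -/
lemma fillIndex_lt_or_isExtended_of_δ_extend {i : Fin (n + 1)} {x : (ex.obj X) _⦋n⦌}
    (hi₀ : i.val ≠ 0) {j : Fin (n + 2)} (hj : j ≠ i.succ) :
    fillIndex ((ex.obj X).δ j (extend i x)) < i.val ∨ IsExtended ((ex.obj X).δ j (extend i x)) := by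
  obtain ⟨k, hk⟩ := Nat.exists_eq_succ_of_ne_zero hi₀
  rw [← Fin.val_ne_iff, Fin.val_succ] at hj
  have hi := isFilled_extend i x
  obtain h | h := le_or_gt j.val i.val
  · rw [hk] at hi
    have := (isFilled_iff _ _).1 (hi.δ_of_le (i := j) (by lia))
    exact Or.inl (by lia)
  · have h₁ := (isFilled_iff _ _).1 (hi.δ_of_lt h)
    obtain h₂ | h₂ := h₁.lt_or_eq
    · exact Or.inl h₂
    -- Now j > i + 1, so the face retains the doubled vertices i and i + 1, which is what makes it
    -- extended.
    · refine Or.inr ⟨by lia, ?_⟩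
      rw [h₂]
      have h₃ : (ex.obj X).δ j (extend i x) =
          fill i.val (SimplexCategory.δ j ≫ SimplexCategory.σ i) x :=
        map_fill i.val _ _ (fun a ↦ by rw [val_δ]; split_ifs <;> lia) x
      rw [h₃]
      have h₄ (a : Fin (n + 1)) : ((SimplexCategory.δ j ≫ SimplexCategory.σ i) a).val =
          if a.val ≤ i.val then a.val else if a.val < j.val then a.val - 1 else a.val := by
        change (SimplexCategory.σ i (SimplexCategory.δ j a)).val = _
        rw [val_σ, val_δ]
        split_ifs <;> lia
      refine (fill_fill_of_val_eq i.val _ _ (fun a ↦ ?_) (fun a ha ↦ ?_) x).trans ?_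
      · rw [val_collapse]
        split_ifs <;> lia
      · rw [h₄, if_pos ha]
      · congr 1
        refine hom_ext_val fun a ↦ ?_
        change ((SimplexCategory.δ j ≫ SimplexCategory.σ i) (collapse _ _ a)).val = _
        rw [h₄, h₄, val_collapse]
        split_ifs <;> lia

lemma map_collapse_of_σ (i : Fin (n + 1)) (x : (ex.obj X) _⦋n⦌) :
    (ex.obj X).map (collapse (n + 1) i.val).op ((ex.obj X).σ i x) = (ex.obj X).σ i x := by
  dsimp [SimplicialObject.σ]
  rw [← Functor.map_comp_apply, ← op_comp]
  congr 4
  refine hom_ext_val fun a ↦ ?_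
  change (SimplexCategory.σ i (collapse _ _ a)).val = _
  rw [val_σ, val_collapse, val_σ]
  split_ifs <;> lia

lemma extend_mem_nonDegenerate {i : Fin (n + 1)} {x : (ex.obj X) _⦋n⦌}
    (hx : x ∈ (ex.obj X).nonDegenerate n) (hi : fillIndex x = i.val) (hi₀ : i.val ≠ 0)
    (hx' : ¬ IsExtended x) : extend i x ∈ (ex.obj X).nonDegenerate (n + 1) := by
  by_contra hy
  rw [← mem_degenerate_iff_notMem_nonDegenerate, degenerate_eq_iUnion_range_σ,
    Set.mem_iUnion] at hy
  obtain ⟨j, z, hz⟩ := hy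
  have hδ := δ_extend ((isFilled_iff _ _).2 hi.le)
  have hyi := fillIndex_extend hi
  -- Degeneracy at i would lower the fill index.
  by_cases h : j.val = i.val
  · obtain ⟨k, hk⟩ := Nat.exists_eq_succ_of_ne_zero hi₀
    have := isFilled_extend i x
    rw [← hz, hk] at this
    have := (isFilled_iff _ _).1 (this.of_eq_σ (by lia))
    rw [hz] at this
    lia
  -- Degeneracy at i + 1 would identify i + 1 and i + 2, and after removal of i + 1 this makes `x`
  -- extended.
  by_cases h' : j.val = i.val + 1
  · refine hx' ⟨by lia, ?_⟩
    have h₁ := map_collapse_of_σ j z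
    rw [hz, h'] at h₁
    conv_rhs => rw [← hδ, ← h₁]
    dsimp [SimplicialObject.δ]
    rw [← Functor.map_comp_apply, ← op_comp]
    refine Eq.trans ?_ (map_fill i.val _ _ (fun a ↦ ?_) x).symm
    · rw [hi]
      congr 1
      refine hom_ext_val fun a ↦ ?_
      change _ = (SimplexCategory.σ i (collapse _ _ (SimplexCategory.δ i.succ a))).val
      simp only [val_σ, val_δ, val_collapse, Fin.val_succ]
      split_ifs <;> lia
    · change _ ↔ (collapse _ _ (SimplexCategory.δ i.succ a)).val ≤ _
      simp only [val_δ, val_collapse, Fin.val_succ]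
      split_ifs <;> lia
  -- In the remaining cases the degeneracy survives on the face i + 1, so `x` would be degenerate.
  · rw [← hz] at hδ
    dsimp [SimplicialObject.σ, SimplicialObject.δ] at hδ
    rw [← Functor.map_comp_apply, ← op_comp] at hδ
    have hf := mono_of_nonDegenerate (x := ⟨x, hx⟩) _ _ _ hδ
    rw [SimplexCategory.mono_iff_injective] at hf
    have key (a b : Fin (n + 1)) (hab : (SimplexCategory.σ j (SimplexCategory.δ i.succ a)).val =
        (SimplexCategory.σ j (SimplexCategory.δ i.succ b)).val) : a.val = b.val :=
      congr_arg Fin.val (hf (Fin.ext hab))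
    simp only [val_σ, val_δ, Fin.val_succ] at key
    obtain h₁ | h₁ := lt_or_gt_of_ne h
    · have := key ⟨j.val, by lia⟩ ⟨j.val + 1, by lia⟩ (by split_ifs <;> lia)
      simp at this
    · have := key ⟨j.val, by lia⟩ ⟨j.val - 1, by lia⟩ (by split_ifs <;> lia)
      dsimp at this
      lia

end SSet.Ex

/-! ### Recovering seeds from extended simplices; the image of `X` -/

namespace SSet.Ex

open SimplexCategory (val_δ val_σ val_collapse collapse hom_ext_val not_mono_collapse)

variable {X : SSet.{u}} {l m n : ℕ}

section

variable {i : Fin (n + 1)} {x : (ex.obj X) _⦋n + 1⦌}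

/-- Removing the vertex i + 1 and then doubling i amounts to the collapse of i + 1 onto i, which
fixes an extended simplex after filling. -/
lemma extend_δ (hi : fillIndex x = i.val) (hx : IsExtended x) :
    extend i ((ex.obj X).δ i.succ x) = x := by
  have h₁ : (ex.obj X).δ i.succ x = fill i.val (SimplexCategory.δ i.succ) x := by
    conv_lhs => rw [← (isFilled_iff _ _).2 hi.le]
    refine (map_fill i.val _ _ (fun a ↦ ?_) x).trans (by rw [Category.comp_id])
    rw [val_δ, Fin.val_succ]
    split_ifs <;> lia
  have h₂ := hx.2
  rw [hi] at h₂
  rw [h₁]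
  refine (fill_fill_of_val_eq i.val _ _ (fun a ↦ ?_) (fun a ha ↦ ?_) x).trans
    (Eq.trans ?_ h₂)
  · rw [val_σ]
    split_ifs <;> lia
  · rw [val_δ, Fin.val_succ, if_pos (by lia)]
  · congr 1
    refine hom_ext_val fun a ↦ ?_
    change (SimplexCategory.δ i.succ (SimplexCategory.σ i a)).val = _
    rw [val_collapse, val_δ, val_σ, Fin.val_succ]
    split_ifs <;> lia

/-- If the face were filled above some k < i, so would be its extension, which is `x`. -/
lemma fillIndex_δ (hi : fillIndex x = i.val) (hx : IsExtended x) :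
    fillIndex ((ex.obj X).δ i.succ x) = i.val := by
  refine le_antisymm ((isFilled_iff _ _).1 (((isFilled_iff _ _).2 hi.le).δ_of_lt
    (by rw [Fin.val_succ]; lia))) ?_
  by_contra! h
  set k := fillIndex ((ex.obj X).δ i.succ x)
  have h₁ : fill k (𝟙 _) ((ex.obj X).δ i.succ x) = (ex.obj X).δ i.succ x :=
    isFilled_fillIndex ((ex.obj X).δ i.succ x)
  have h₂ := extend_δ hi hx
  rw [← h₁] at h₂
  have h₃ := fill_fill_of_val_eq (k := i.val) (k' := k) k (SimplexCategory.σ i) (𝟙 _) (fun a ↦ by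
    rw [val_σ]
    split_ifs <;> lia) (fun a _ ↦ rfl) ((ex.obj X).δ i.succ x)
  have h₄ := isFilled_fill k (SimplexCategory.σ i ≫ 𝟙 _) ((ex.obj X).δ i.succ x)
  rw [← h₃] at h₄
  change IsFilled k (extend i _) at h₄
  rw [h₂, isFilled_iff] at h₄
  lia

/-- Otherwise i, i + 1 and i + 2 would all be identified above the threshold, so `x` would be
invariant under the non-injective collapse of i + 2 onto i + 1, hence degenerate. -/
lemma not_isExtended_δ (hx : x ∈ (ex.obj X).nonDegenerate (n + 1))
    (hi : fillIndex x = i.val) (hx' : IsExtended x) :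
    ¬ IsExtended ((ex.obj X).δ i.succ x) := by
  rintro ⟨h₁, h₂⟩
  rw [fillIndex_δ hi hx'] at h₁ h₂
  have h₃ := extend_δ hi hx'
  have h₄ : x = fill i.val (SimplexCategory.σ i ≫ collapse n i.val) ((ex.obj X).δ i.succ x) := by
    conv_lhs => rw [← h₃, ← h₂]
    refine fill_fill_of_val_eq (k := i.val) (k' := i.val) i.val _ _ (fun a ↦ ?_) (fun a ha ↦ ?_) _
    · rw [val_σ]
      split_ifs <;> lia
    · rw [val_collapse, if_neg (by lia)]
  have h₅ : (ex.obj X).map (collapse (n + 1) (i.val + 1)).op x = x := by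
    conv_lhs => rw [h₄]
    conv_rhs => rw [h₄]
    refine (map_fill i.val _ _ (fun a ↦ ?_) _).trans ?_
    · rw [val_collapse]
      split_ifs <;> lia
    · congr 1
      refine hom_ext_val fun a ↦ ?_
      change (collapse _ _ (SimplexCategory.σ i (collapse _ _ a))).val =
        (collapse _ _ (SimplexCategory.σ i a)).val
      simp only [val_collapse, val_σ]
      split_ifs <;> lia
  exact not_mono_collapse (by lia) (mono_of_nonDegenerate (x := ⟨x, hx⟩) _ _ _ h₅)

lemma δ_mem_nonDegenerate (hx : x ∈ (ex.obj X).nonDegenerate (n + 1))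
    (hi : fillIndex x = i.val) (hi₀ : i.val ≠ 0) (hx' : IsExtended x) :
    (ex.obj X).δ i.succ x ∈ (ex.obj X).nonDegenerate n := by
  obtain _ | n := n
  · exact (hi₀ (by lia)).elim
  by_contra hy
  rw [← mem_degenerate_iff_notMem_nonDegenerate, degenerate_eq_iUnion_range_σ,
    Set.mem_iUnion] at hy
  obtain ⟨j, w, hw⟩ := hy
  have h₁ := extend_δ hi hx'
  have h₂ := fillIndex_δ hi hx'
  by_cases h : j.val = i.val
  · obtain ⟨k, hk⟩ := Nat.exists_eq_succ_of_ne_zero hi₀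
    have := (isFilled_iff _ _).2 h₂.le
    rw [← hw, hk] at this
    have := (isFilled_iff _ _).1 (this.of_eq_σ (by lia))
    rw [hw] at this
    lia
  · rw [← hw] at h₁
    have h₃ : x = fill i.val (SimplexCategory.σ i ≫ SimplexCategory.σ j) w :=
      h₁.symm.trans (fill_map _ _ _)
    -- The simplicial identity for σ_i followed by σ_j moves the degeneracy coming from j to the
    -- outside: its index stays j if j < i and becomes j + 1 if j > i.
    refine hx ⟨n + 1, by lia, if j.val < i.val then SimplexCategory.σ j.castSucc else
      SimplexCategory.σ j.succ, ?_⟩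
    split_ifs with h'
    · refine ⟨fill (i.val - 1) (SimplexCategory.σ ⟨i.val - 1, by lia⟩) w, ?_⟩
      rw [h₃]
      refine (map_fill i.val _ _ (fun a ↦ ?_) _).trans ?_
      · rw [val_σ, Fin.val_castSucc]
        split_ifs <;> lia
      · congr 1
        refine hom_ext_val fun a ↦ ?_
        change (SimplexCategory.σ _ (SimplexCategory.σ _ a)).val =
          (SimplexCategory.σ _ (SimplexCategory.σ _ a)).val
        simp only [val_σ, Fin.val_castSucc]
        split_ifs <;> lia
    · refine ⟨fill i.val (SimplexCategory.σ ⟨i.val, by lia⟩) w, ?_⟩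
      rw [h₃]
      refine (map_fill i.val _ _ (fun a ↦ ?_) _).trans ?_
      · rw [val_σ, Fin.val_succ]
        split_ifs <;> lia
      · congr 1
        refine hom_ext_val fun a ↦ ?_
        change (SimplexCategory.σ _ (SimplexCategory.σ _ a)).val =
          (SimplexCategory.σ _ (SimplexCategory.σ _ a)).val
        simp only [val_σ, Fin.val_succ]
        split_ifs <;> lia

end

/-- The section of the last-vertex map which sends `i` to `{0, ..., i}`. -/
noncomputable def initialSection (n : ℕ) :
    stdSimplex.{u}.obj ⦋n⦌ ⟶ SimplexCategory.sd.{u}.obj ⦋n⦌ where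
  app _ := ↾fun s ↦ (Monotone.functor (f := fun i ↦ Faces.initial.{u} (stdSimplex.objEquiv s i))
    (fun _ _ h ↦ Faces.initial_monotone ((stdSimplex.objEquiv s).toOrderHom.monotone h)))
  naturality _ _ _ := rfl

lemma initialSection_lastVertex (n : ℕ) :
    initialSection.{u} n ≫ lastVertex.{u}.app ⦋n⦌ = 𝟙 _ := by
  ext d s
  apply stdSimplex.objEquiv.injective
  ext i : 3
  exact Faces.lastVertexOf_initial _

/-- Filling above 0 leaves sets with maximum 0 alone, but {0} is the only such set and is already
initial. -/
lemma initial_lastVertexOf (s : Faces.{u} n) :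
    Faces.initial (lastVertexOf s) = Faces.mapFill 0 (𝟙 ⦋n⦌) s := by
  obtain h | h := Nat.eq_zero_or_pos (lastVertexOf s).val
  · rw [Faces.mapFill_of_le _ h.le, Faces.map_id]
    refine le_antisymm (fun a ha ↦ ?_) (Faces.le_initial_lastVertexOf s)
    have : a = ULift.up (lastVertexOf s) := ULift.ext _ _
      (le_antisymm ((Faces.mem_initial _ _).1 ha) (Fin.le_def.2 (by lia)))
    rw [this]
    exact Faces.lastVertexOf_mem s
  · exact (Faces.mapFill_of_lt (𝟙 ⦋n⦌) h).symm

lemma lastVertex_initialSection (n : ℕ) :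
    lastVertex.{u}.app ⦋n⦌ ≫ initialSection.{u} n =
      PartOrd.nerveFunctor.map (PartOrd.ofHom (Faces.mapFill 0 (𝟙 ⦋n⦌))) := by
  ext d s
  exact CategoryTheory.Functor.ext (fun i ↦ initial_lastVertexOf (s.obj i))
    (fun _ _ _ ↦ Subsingleton.elim _ _)

lemma toEx_app (x : X _⦋n⦌) :
    (toEx X).app (op ⦋n⦌) x = ULift.up (lastVertex.{u}.app ⦋n⦌ ≫ yonedaEquiv.symm x) := rfl

instance mono_toEx : Mono (toEx X) := by
  rw [NatTrans.mono_iff_mono_app]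
  rintro ⟨⟨n⟩⟩
  rw [mono_iff_injective]
  intro x y h
  have h' := congr_arg (fun z ↦ initialSection n ≫ z) (congr_arg ULift.down h)
  change initialSection n ≫ lastVertex.{u}.app ⦋n⦌ ≫ yonedaEquiv.symm x =
    initialSection n ≫ lastVertex.{u}.app ⦋n⦌ ≫ yonedaEquiv.symm y at h'
  rw [← Category.assoc, ← Category.assoc, initialSection_lastVertex, Category.id_comp,
    Category.id_comp] at h'
  exact yonedaEquiv.symm.injective h'

lemma mem_range_toEx_iff (x : (ex.obj X) _⦋n⦌) :
    x ∈ (Subcomplex.range (toEx X)).obj (op ⦋n⦌) ↔ fillIndex x = 0 := by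
  rw [← Nat.le_zero, ← isFilled_iff]
  have h : fill 0 (𝟙 _) x = ULift.up (lastVertex.{u}.app ⦋n⦌ ≫ initialSection n ≫ x.down) := by
    rw [← Category.assoc, lastVertex_initialSection]
    rfl
  rw [IsFilled, h]
  constructor
  · rintro ⟨y, rfl⟩
    rw [toEx_app]
    dsimp only
    rw [← Category.assoc (initialSection n), initialSection_lastVertex, Category.id_comp]
  · intro hx
    refine ⟨yonedaEquiv (initialSection n ≫ x.down), ?_⟩
    rw [toEx_app, Equiv.symm_apply_apply, hx]

end SSet.Ex

/-! ### The regular pairing -/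

namespace SSet.Ex

variable (X : SSet.{u})

/-- The simplices of `Ex X` which are used in order to attach new simplices: the
nondegenerate simplices that are not in the image of `X` and are not extended. -/
structure Seed where
  /-- the dimension -/
  dim : ℕ
  /-- the simplex -/
  simplex : (ex.obj X) _⦋dim⦌
  nonDegenerate : simplex ∈ (ex.obj X).nonDegenerate dim
  fillIndex_ne_zero : fillIndex simplex ≠ 0
  not_isExtended : ¬ IsExtended simplex

variable {X}

/-- The fill index of a seed, as an element of `Fin (s.dim + 1)`. -/
noncomputable def Seed.index (s : Seed X) : Fin (s.dim + 1) :=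
  ⟨fillIndex s.simplex, by have := fillIndex_le s.simplex; lia⟩

lemma Seed.δ_extend (s : Seed X) :
    (ex.obj X).δ s.index.succ (extend s.index s.simplex) = s.simplex :=
  Ex.δ_extend (isFilled_fillIndex _)

variable (X) in
/-- The pairing for the inclusion of `X` in `Ex X`. -/
noncomputable def pairingCore : (Subcomplex.range (toEx X)).PairingCore where
  ι := Seed X
  dim s := s.dim
  simplex s := extend s.index s.simplex
  index s := s.index.succ
  nonDegenerate₁ s := extend_mem_nonDegenerate s.nonDegenerate rfl s.fillIndex_ne_zero
    s.not_isExtended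
  nonDegenerate₂ s := by
    rw [s.δ_extend]
    exact s.nonDegenerate
  notMem₁ s := by
    rw [mem_range_toEx_iff, fillIndex_extend rfl]
    exact s.fillIndex_ne_zero
  notMem₂ s := by
    rw [s.δ_extend, mem_range_toEx_iff]
    exact s.fillIndex_ne_zero
  injective_type₁' {s t} h := by
    obtain ⟨n, x, hx₁, hx₂, hx₃⟩ := s
    obtain ⟨m, y, hy₁, hy₂, hy₃⟩ := t
    obtain rfl : n = m := Nat.succ_injective (congr_arg S.dim h)
    rw [S.ext_iff] at h
    dsimp only at h
    -- Equal fill indices let a single face operator recover both seeds from their common extension.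
    have hi : fillIndex x = fillIndex y := by
      have := congr_arg fillIndex h
      rwa [fillIndex_extend rfl, fillIndex_extend rfl] at this
    have hi' : Seed.index ⟨n, x, hx₁, hx₂, hx₃⟩ = Seed.index ⟨n, y, hy₁, hy₂, hy₃⟩ := Fin.ext hi
    have hs := Seed.δ_extend ⟨n, x, hx₁, hx₂, hx₃⟩
    have ht := Seed.δ_extend ⟨n, y, hy₁, hy₂, hy₃⟩
    dsimp only at hs ht
    rw [hi'] at h hs
    rw [h, ht] at hs
    subst hs
    rfl
  injective_type₂' {s t} h := by
    rw [s.δ_extend, t.δ_extend] at h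
    obtain ⟨n, x, hx₁, hx₂, hx₃⟩ := s
    obtain ⟨m, y, hy₁, hy₂, hy₃⟩ := t
    obtain rfl : n = m := congr_arg S.dim h
    rw [S.ext_iff] at h
    subst h
    rfl
  type₁_ne_type₂' s t h := by
    rw [t.δ_extend] at h
    obtain ⟨m, y, hy₁, hy₂, hy₃⟩ := t
    obtain rfl : s.dim + 1 = m := congr_arg S.dim h
    rw [S.ext_iff] at h
    subst h
    exact hy₃ (isExtended_extend rfl)
  surjective' x := by
    obtain ⟨n, x, hx, hx', rfl⟩ := x.mk_surjective
    rw [mem_range_toEx_iff] at hx'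
    by_cases h : IsExtended x
    · obtain _ | n := n
      · exact (Nat.not_lt_zero _ h.1).elim
      obtain ⟨i, hi⟩ : ∃ (i : Fin (n + 1)), fillIndex x = i.val := ⟨⟨_, h.1⟩, rfl⟩
      let s : Seed X :=
        { dim := n
          simplex := (ex.obj X).δ i.succ x
          nonDegenerate := δ_mem_nonDegenerate hx hi (by lia) h
          fillIndex_ne_zero := by rwa [fillIndex_δ hi h, ← hi]
          not_isExtended := not_isExtended_δ hx hi h }
      have hs : s.index = i := Fin.ext (fillIndex_δ hi h)
      refine ⟨s, Or.inl ?_⟩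
      rw [hs]
      exact (congr_arg S.mk (extend_δ hi h)).symm
    · exact ⟨⟨n, x, hx, hx', h⟩, Or.inr (by rw [Seed.δ_extend]; rfl)⟩

lemma Seed.fillIndex_lt (s : Seed X) {x : (ex.obj X) _⦋s.dim⦌} (hx : ¬ IsExtended x)
    {j : Fin (s.dim + 2)} (hj : j ≠ s.index.succ)
    (h : (ex.obj X).δ j (extend s.index s.simplex) = x) :
    fillIndex x < fillIndex s.simplex := by
  subst h
  exact (fillIndex_lt_or_isExtended_of_δ_extend s.fillIndex_ne_zero hj).resolve_right hx

instance : (pairingCore X).IsProper where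
  isUniquelyCodimOneFace s := by
    refine (S.IsUniquelyCodimOneFace.iff _ _).2 ⟨s.index.succ, rfl, fun j hj ↦ ?_⟩
    by_contra h
    -- Another face equal to the seed, which is not extended, would have a fill index smaller than
    -- its own.
    exact (lt_irrefl _) (s.fillIndex_lt s.not_isExtended h (hj.trans s.δ_extend))

variable (X) in
/-- The fill index is a weak rank function. -/
noncomputable def weakRankFunction : (pairingCore X).WeakRankFunction ℕ where
  rank s := fillIndex s.simplex
  lt {s t} h hdim := by
    obtain ⟨hst, hlt⟩ := h
    obtain ⟨f, hf', hf⟩ := SSet.N.le_iff_exists_mono.1 (Subcomplex.N.le_iff.1 hlt.le)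
    change ⦋s.dim⦌ ⟶ ⦋t.dim + 1⦌ at f
    change (ex.obj X).map f.op (extend t.index t.simplex) =
      (ex.obj X).δ s.index.succ (extend s.index s.simplex) at hf
    rw [s.δ_extend] at hf
    change s.dim = t.dim at hdim
    obtain ⟨n, x, hx₁, hx₂, hx₃⟩ := s
    dsimp only at hdim hf
    subst hdim
    have : @Mono _ _ ⦋t.dim⦌ ⦋t.dim + 1⦌ f := hf'
    clear hf'
    -- Equality of dimensions makes the inclusion a coface; it cannot be the one that recovers `t`,
    -- since the two seeds differ.
    obtain ⟨j, rfl⟩ := SimplexCategory.eq_δ_of_mono f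
    refine t.fillIndex_lt hx₃ ?_ hf
    rintro rfl
    obtain rfl := hf.symm.trans t.δ_extend
    exact hst rfl

lemma isRegular_pairingCore (X : SSet.{u}) : (pairingCore X).IsRegular :=
  (weakRankFunction X).isRegular

end SSet.Ex

theorem mainTheorem1 (X : SSet.{u}) :
    SSet.IsStrongAnodyneExtension (SSet.toEx X) := by
  have := SSet.Ex.isRegular_pairingCore X
  exact ⟨inferInstance, ⟨(SSet.Ex.pairingCore X).pairing.anodynePresentation⟩⟩
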